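/- **Conventions.** A *quantum set* $(B,\psi)$ is a finite-dimensional C*-algebra $B$ with a faithful positive functional $\psi$ such that $mm^*=\mathrm{id}_B$, where $m\colon B\otimes B\to B$ is the multiplication and adjoints are taken for $\langle a,b\rangle_\psi=\psi(a^*b)$. A *quantum graph* on it is a linear map $A\colon B\to B$ with $m(A\otimes A)m^*=A$ and $A(b^*)=A(b)^*$. Quantum graphs $A_1$ on $(B_1,\psi_1)$ and $A_2$ on $(B_2,\psi_2)$ are *quantum isomorphic*, $A_1\cong_q A_2$, if there are a nonzero finite-dimensional Hilbert space $\mathcal H$ and a unital $*$-homomorphism $\rho\colon B_1\to B_2\otimes B(\mathcal H)$ such that $L^2(B_1)\otimes\mathcal H\to L^2(B_2)\otimes\mathcal H$, $a\otimes\xi\mapsto\rho(a)(1\otimes\xi)$, is unitary and $\rho A_1=(A_2\otimes\mathrm{id}_{B(\mathcal H)})\rho$. For a finite set $X$ let $\psi_X(f)=\sum_{x\in X}f(x)$ on $\mathbb C^X$; a finite simple directed graph on $X$ (loops allowed) is identified with the quantum graph $e_x\mapsto\sum_{x\to y}e_y$ on $(\mathbb C^X,\psi_X)$. **Voltage graphs.**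 Let $G$ be a finite abelian group, written additively, with dual group $\hat G$ and $n=|G|$. Let $(\Gamma,\lambda)$ be a voltage graph: a finite directed multigraph $\Gamma$ with vertex set $V$ and edge set $E$, together with a labeling $\lambda\colon E\to G$. Assume that it is *pre-simple*: for all $u,v\in V$ and $g\in G$ there is at most one edge $u\to v$ with label $g$. Its derived graph $\Gamma^\lambda$ has vertex set $V\times G$ and, for every edge $e\colon u\to v$ of $\Gamma$ and every $g\in G$, one edge $(u,g)\to(v,g+\lambda(e))$. For $g\in G$ let $\tilde A_g\colon\mathbb C^V\to\mathbb C^V$, $e_u\mapsto\sum e_v$, the sum running over the edges $u\to v$ with label $g$. **Derived quantum graph.** Let $\hat G$ act on the set $V$, and let $\hat\alpha$ be the induced action $\hat\alpha_\chi(e_v)=e_{\chi\cdot v}$ on $\mathbb C^V$. On the crossed product $B=\mathbb C^V\rtimes_{\hat\alpha}\hat G=\{\sum_\chi b_\chi u_\chi\}$ put $$\psi_\rtimes\Big(\sum_\chi b_\chi u_\chi\Big)=n\,\psi_V(b_1),\qquad E_\rtimes\Big(\sum_\chi b_\chi u_\chi\Big)=n\,b_1,\qquad X_g(b)=\frac1n\sum_{\chi\in\hat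 G}\overline{\chi(g)}\,\langle u_\chi,b\rangle_{\psi_\rtimes}u_\chi,$$ and let $$\Gamma\rtimes_{\hat\alpha}\hat G:=\sum_{g\in G}m\,(X_g\otimes E_\rtimes^*\tilde A_gE_\rtimes)\,m^*\colon B\to B .$$ **Statement.** Suppose that for every $g\in G$ the set of edges of $\Gamma$ with label $g$, viewed as a subset of $V\times V$, is invariant under the action of $\hat G$. Then $(\tilde A_g)_{g\in G}$ is a voltage quantum graph on $(\mathbb C^V,\psi_V)$ with respect to $\hat\alpha$ (that is, $(\mathbb C^V,\psi_V)$ is a quantum set, $\hat\alpha$ preserves $\psi_V$, each $\tilde A_g$ is a quantum graph on it, and each $\tilde A_g$ commutes with all $\hat\alpha_\chi$); $\Gamma^\lambda$ and $\Gamma\rtimes_{\hat\alpha}\hat G$ are quantum graphs on $(\mathbb C^{V\times G},\psi_{V\times G})$ and $(B,\psi_\rtimes)$, respectively; and $$\Gamma^\lambda\cong_q\Gamma\rtimes_{\hat\alpha}\hat G .$$ -/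

import Mathlib

open scoped TensorProduct ComplexConjugate ComplexOrder

namespace QGraph

universe u v w

/-! ### Sesquilinear forms, adjoints and unitaries

A finite-dimensional C*-algebra `B` with a functional `ψ` is regarded as a Hilbert space via
`⟨a, b⟩ = ψ (a* b)`, and tensor products carry the product inner product. -/

/-- Sesquilinear forms, conjugate-linear in the first variable. -/
abbrev Sesq (M : Type*) [AddCommGroup M] [Module ℂ M] : Type _ := M →ₗ⋆[ℂ] M →ₗ[ℂ] ℂ

section Forms

variable {M : Type*} [AddCommGroup M] [Module ℂ M] {N : Type*} [AddCommGroup N] [Module ℂ N]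

/-- The form on `M ⊗ N` with `⟨a ⊗ b, c ⊗ d⟩ = ⟨a, c⟩ ⟨b, d⟩`. -/
noncomputable def tensorForm (F : Sesq M) (F' : Sesq N) : Sesq (M ⊗[ℂ] N) :=
  (TensorProduct.lift (TensorProduct.mapBilinear (RingHom.id ℂ) M N ℂ ℂ)).compr₂
    (LinearMap.mul' ℂ ℂ) ∘ₛₗ TensorProduct.map F F'

@[simp]
theorem tensorForm_tmul (F : Sesq M) (F' : Sesq N) (a c : M) (b d : N) :
    tensorForm F F' (a ⊗ₜ b) (c ⊗ₜ d) = F a c * F' b d := rfl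

/-- `S` is an adjoint of `T`: `⟨T x, y⟩ = ⟨x, S y⟩`. -/
def IsAdjoint (F : Sesq M) (F' : Sesq N) (T : M →ₗ[ℂ] N) (S : N →ₗ[ℂ] M) : Prop :=
  ∀ x y, F' (T x) y = F x (S y)

open Classical in
/-- The adjoint `T*` of `T`. It exists and is unique whenever both forms are inner products and the
spaces are finite-dimensional (the value is `0` if there is no adjoint). -/
noncomputable def adjoint (F : Sesq M) (F' : Sesq N) (T : M →ₗ[ℂ] N) : N →ₗ[ℂ] M :=
  if h : ∃ S, IsAdjoint F F' T S then h.choose else 0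

/-- A unitary operator: a bijective linear map preserving the inner products. -/
def IsUnitary (F : Sesq M) (F' : Sesq N) (T : M →ₗ[ℂ] N) : Prop :=
  Function.Bijective T ∧ ∀ x y, F' (T x) (T y) = F x y

end Forms

/-! ### Quantum sets and quantum graphs -/

section QuantumSets

variable {B : Type*} [Ring B] [StarRing B] [Algebra ℂ B] [StarModule ℂ B]

/-- The inner product `⟨a, b⟩ = ψ (a* b)`. -/
noncomputable def gns (ψ : B →ₗ[ℂ] ℂ) : Sesq B :=
  LinearMap.mk₂'ₛₗ (starRingEnd ℂ) (RingHom.id ℂ) (fun a b => ψ (star a * b))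
    (fun a a' b => by simp [add_mul]) (fun c a b => by simp)
    (fun a b b' => by simp [mul_add]) (fun c a b => by simp)

@[simp]
theorem gns_apply (ψ : B →ₗ[ℂ] ℂ) (a b : B) : gns ψ a b = ψ (star a * b) := rfl

/-- The comultiplication `m*`, the adjoint of the multiplication map `m : B ⊗ B → B`. -/
noncomputable def comul (ψ : B →ₗ[ℂ] ℂ) : B →ₗ[ℂ] B ⊗[ℂ] B :=
  adjoint (tensorForm (gns ψ) (gns ψ)) (gns ψ) (LinearMap.mul' ℂ B)

/-- The Schur product `m (S ⊗ T) m*`. -/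
noncomputable def schur (ψ : B →ₗ[ℂ] ℂ) (S T : B →ₗ[ℂ] B) : B →ₗ[ℂ] B :=
  LinearMap.mul' ℂ B ∘ₗ TensorProduct.map S T ∘ₗ comul ψ

variable (B) in
/-- A unital complex `*`-algebra is a finite-dimensional C*-algebra iff it is finite-dimensional and
has a C*-norm (which is then complete and unique). -/
def IsFinDimCStarAlgebra : Prop :=
  FiniteDimensional ℂ B ∧ ∃ N : AlgebraNorm ℂ B, ∀ a, N (star a * a) = N a ^ 2

/-- `(B, ψ)` is a quantum set: `B` is a finite-dimensional C*-algebra and `ψ` is a faithful positive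
functional with `m m* = id`. -/
structure IsQuantumSet (ψ : B →ₗ[ℂ] ℂ) : Prop where
  cstar : IsFinDimCStarAlgebra B
  positive : ∀ a, 0 ≤ ψ (star a * a)
  faithful : ∀ a, ψ (star a * a) = 0 → a = 0
  special : LinearMap.mul' ℂ B ∘ₗ comul ψ = LinearMap.id

/-- Quantum adjacency matrices: Schur-idempotent and `*`-preserving linear maps. -/
structure IsQuantumAdjacencyMatrix (ψ : B →ₗ[ℂ] ℂ) (A : B →ₗ[ℂ] B) : Prop where
  schur_idem : schur ψ A A = A
  star_preserving : ∀ b, A (star b) = star (A b)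

/-- `A` is a quantum graph on the quantum set `(B, ψ)`. -/
structure IsQuantumGraph (ψ : B →ₗ[ℂ] ℂ) (A : B →ₗ[ℂ] B) : Prop where
  quantumSet : IsQuantumSet ψ
  adjacency : IsQuantumAdjacencyMatrix ψ A

end QuantumSets

/-! ### Quantum isomorphisms -/

section QuantumIsomorphisms

variable {B₁ : Type*} [Ring B₁] [StarRing B₁] [Algebra ℂ B₁] [StarModule ℂ B₁]
  {B₂ : Type*} [Ring B₂] [StarRing B₂] [Algebra ℂ B₂] [StarModule ℂ B₂]
  {H : Type*} [NormedAddCommGroup H] [InnerProductSpace ℂ H] [CompleteSpace H]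

variable (B₂ H) in
/-- The action of `B₂ ⊗ B(H)` on `L²(B₂) ⊗ H`, `(b ⊗ T) (c ⊗ ξ) = b c ⊗ T ξ`. -/
noncomputable def tensorAct :
    B₂ ⊗[ℂ] (H →L[ℂ] H) →ₗ[ℂ] (B₂ ⊗[ℂ] H) →ₗ[ℂ] (B₂ ⊗[ℂ] H) :=
  TensorProduct.map₂ (LinearMap.mul ℂ B₂) (ContinuousLinearMap.coeLM ℂ)

/-- The map `p : L²(B₁) ⊗ H → L²(B₂) ⊗ H`, `a ⊗ ξ ↦ ρ(a) (1 ⊗ ξ)`. -/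
noncomputable def isoMap (ρ : B₁ →⋆ₐ[ℂ] B₂ ⊗[ℂ] (H →L[ℂ] H)) :
    B₁ ⊗[ℂ] H →ₗ[ℂ] B₂ ⊗[ℂ] H :=
  TensorProduct.lift <|
    LinearMap.mk₂ ℂ (fun a ξ => tensorAct B₂ H (ρ a) (1 ⊗ₜ[ℂ] ξ))
      (fun a a' ξ => by simp) (fun c a ξ => by simp)
      (fun a ξ ξ' => by simp [TensorProduct.tmul_add]) (fun c a ξ => by simp)

/-- `ρ` is a quantum isomorphism between the quantum sets `(B₁, ψ₁)` and `(B₂, ψ₂)`. -/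
def IsQuantumSetIso (ψ₁ : B₁ →ₗ[ℂ] ℂ) (ψ₂ : B₂ →ₗ[ℂ] ℂ)
    (ρ : B₁ →⋆ₐ[ℂ] B₂ ⊗[ℂ] (H →L[ℂ] H)) : Prop :=
  IsUnitary (tensorForm (gns ψ₁) (innerₛₗ ℂ)) (tensorForm (gns ψ₂) (innerₛₗ ℂ)) (isoMap ρ)

/-- The quantum graphs `A₁` on `(B₁, ψ₁)` and `A₂` on `(B₂, ψ₂)` are quantum isomorphic: there are a
nonzero finite-dimensional Hilbert space `H` and a quantum isomorphism `ρ : B₁ → B₂ ⊗ B(H)` of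
quantum sets with `ρ A₁ = (A₂ ⊗ id) ρ`. -/
def QuantumIsomorphic (ψ₁ : B₁ →ₗ[ℂ] ℂ) (A₁ : B₁ →ₗ[ℂ] B₁)
    (ψ₂ : B₂ →ₗ[ℂ] ℂ) (A₂ : B₂ →ₗ[ℂ] B₂) : Prop :=
  IsQuantumGraph ψ₁ A₁ ∧ IsQuantumGraph ψ₂ A₂ ∧
  ∃ (H : Type) (_ : NormedAddCommGroup H) (_ : InnerProductSpace ℂ H) (_ : CompleteSpace H)
    (ρ : B₁ →⋆ₐ[ℂ] B₂ ⊗[ℂ] (H →L[ℂ] H)),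
    FiniteDimensional ℂ H ∧ Nontrivial H ∧ IsQuantumSetIso ψ₁ ψ₂ ρ ∧
    ∀ a, ρ (A₁ a) = TensorProduct.map A₂ LinearMap.id (ρ a)

end QuantumIsomorphisms

/-! ### Crossed products by finite groups -/

/-- The crossed product `B ⋊_α K` by a finite group `K`; its elements are the formal sums
`∑ χ, b_χ u_χ`, stored by their coefficients. -/
@[ext]
structure CrossedProduct {K : Type u} {B : Type v} [Group K] [Ring B] [StarRing B] [Algebra ℂ B]
    (α : K →* (B ≃⋆ₐ[ℂ] B)) where
  coeff : K → B

namespace CrossedProduct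

variable {K : Type u} {B : Type v} [Group K] [Ring B] [StarRing B] [Algebra ℂ B]
  {α : K →* (B ≃⋆ₐ[ℂ] B)}

instance : Zero (CrossedProduct α) := ⟨⟨0⟩⟩
instance : Add (CrossedProduct α) := ⟨fun x y => ⟨x.coeff + y.coeff⟩⟩
instance : Neg (CrossedProduct α) := ⟨fun x => ⟨-x.coeff⟩⟩
instance : Sub (CrossedProduct α) := ⟨fun x y => ⟨x.coeff - y.coeff⟩⟩
instance {R : Type*} [SMul R B] : SMul R (CrossedProduct α) := ⟨fun c x => ⟨c • x.coeff⟩⟩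

@[simp] theorem coeff_zero : (0 : CrossedProduct α).coeff = 0 := rfl
@[simp] theorem coeff_add (x y : CrossedProduct α) : (x + y).coeff = x.coeff + y.coeff := rfl
@[simp] theorem coeff_neg (x : CrossedProduct α) : (-x).coeff = -x.coeff := rfl
@[simp] theorem coeff_sub (x y : CrossedProduct α) : (x - y).coeff = x.coeff - y.coeff := rfl
@[simp] theorem coeff_smul {R : Type*} [SMul R B] (c : R) (x : CrossedProduct α) :
    (c • x).coeff = c • x.coeff := rfl

theorem coeff_injective : Function.Injective (coeff : CrossedProduct α → K → B) :=
  fun _ _ h => CrossedProduct.ext h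

instance : AddCommGroup (CrossedProduct α) :=
  coeff_injective.addCommGroup coeff rfl (fun _ _ => rfl) (fun _ => rfl) (fun _ _ => rfl)
    (fun _ _ => rfl) (fun _ _ => rfl)

instance : Module ℂ (CrossedProduct α) :=
  coeff_injective.module ℂ ⟨⟨coeff, rfl⟩, fun _ _ => rfl⟩ (fun _ _ => rfl)

open Classical in
/-- The element `b u_χ`. -/
noncomputable def single (χ : K) (b : B) : CrossedProduct α := ⟨Pi.single χ b⟩

/-- The canonical unitary `u_χ`. -/
noncomputable def u (χ : K) : CrossedProduct α := single χ 1

noncomputable instance : One (CrossedProduct α) := ⟨single 1 1⟩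

theorem coeff_one [DecidableEq K] (χ : K) :
    (1 : CrossedProduct α).coeff χ = if χ = 1 then 1 else 0 := by
  change (single 1 1 : CrossedProduct α).coeff χ = _
  simp [single, Pi.single_apply]

/-- Determined by `(b_χ u_χ)* = α_{χ⁻¹}(b_χ*) u_{χ⁻¹}`. -/
instance : Star (CrossedProduct α) := ⟨fun x => ⟨fun χ => α χ (star (x.coeff χ⁻¹))⟩⟩

@[simp] theorem coeff_star (x : CrossedProduct α) (χ : K) :
    (star x).coeff χ = α χ (star (x.coeff χ⁻¹)) := rfl

variable [Fintype K]

/-- Determined by `(b_χ u_χ) (c_ξ u_ξ) = b_χ α_χ(c_ξ) u_{χ ξ}`. -/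
instance : Mul (CrossedProduct α) :=
  ⟨fun x y => ⟨fun χ => ∑ ξ, x.coeff ξ * α ξ (y.coeff (ξ⁻¹ * χ))⟩⟩

theorem coeff_mul (x y : CrossedProduct α) (χ : K) :
    (x * y).coeff χ = ∑ ξ, x.coeff ξ * α ξ (y.coeff (ξ⁻¹ * χ)) := rfl

noncomputable instance : Ring (CrossedProduct α) where
  __ := (inferInstance : AddCommGroup (CrossedProduct α))
  left_distrib x y z := by
    ext χ; simp [coeff_mul, mul_add, Finset.sum_add_distrib]
  right_distrib x y z := by
    ext χ; simp [coeff_mul, add_mul, Finset.sum_add_distrib]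
  zero_mul x := by ext χ; simp [coeff_mul]
  mul_zero x := by ext χ; simp [coeff_mul]
  one_mul x := by
    classical
    ext χ; simp [coeff_mul, coeff_one, ite_mul]
  mul_one x := by
    classical
    ext χ
    rw [coeff_mul, Finset.sum_eq_single χ]
    · simp [coeff_one]
    · intro ξ _ h
      have : ξ⁻¹ * χ ≠ 1 := fun h' => h (inv_mul_eq_one.mp h')
      simp [coeff_one, this]
    · simp
  mul_assoc x y z := by
    ext χ
    simp only [coeff_mul, Finset.sum_mul, map_sum, map_mul, Finset.mul_sum]
    rw [Finset.sum_comm]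
    refine Finset.sum_congr rfl fun ξ _ => ?_
    refine Fintype.sum_equiv (Equiv.mulLeft ξ⁻¹) _ _ fun ζ => ?_
    have h : α ζ = α ξ * α (ξ⁻¹ * ζ) := by rw [← map_mul, mul_inv_cancel_left]
    rw [h, StarAlgEquiv.mul_apply]
    simp [mul_assoc]

noncomputable instance : Algebra ℂ (CrossedProduct α) :=
  Algebra.ofModule
    (fun c x y => by ext χ; simp [coeff_mul, Finset.smul_sum])
    (fun c x y => by ext χ; simp [coeff_mul, Finset.smul_sum])

noncomputable instance : StarRing (CrossedProduct α) where
  star_involutive x := by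
    ext χ
    simp only [coeff_star, inv_inv, ← map_star, star_star]
    rw [← StarAlgEquiv.mul_apply, ← map_mul, mul_inv_cancel, map_one, StarAlgEquiv.one_apply]
  star_mul x y := by
    ext χ
    simp only [coeff_star, coeff_mul, star_sum, map_sum, star_mul, map_mul, ← map_star]
    refine Fintype.sum_equiv (Equiv.mulLeft χ) _ _ fun ξ => ?_
    simp only [Equiv.coe_mulLeft, ← StarAlgEquiv.mul_apply, ← map_mul]
    simp
  star_add x y := by ext χ; simp

instance [StarModule ℂ B] : StarModule ℂ (CrossedProduct α) where
  star_smul c x := by ext χ; simp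

variable (α) in
/-- The functional `ψ_⋊ (∑ χ, b_χ u_χ) = n ψ(b_1)` with `n = |K|`. -/
noncomputable def functional (ψ : B →ₗ[ℂ] ℂ) : CrossedProduct α →ₗ[ℂ] ℂ where
  toFun x := (Fintype.card K : ℂ) * ψ (x.coeff 1)
  map_add' x y := by simp [mul_add]
  map_smul' c x := by simp [mul_left_comm]

variable (α) in
/-- The scaled conditional expectation `E (∑ χ, b_χ u_χ) = n b_1` with `n = |K|`. -/
noncomputable def expect : CrossedProduct α →ₗ[ℂ] B where
  toFun x := (Fintype.card K : ℂ) • x.coeff 1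
  map_add' x y := by simp
  map_smul' c x := by simp [smul_comm c]

end CrossedProduct

/-! ### Voltage quantum graphs and derived quantum graphs

`G` is a finite abelian group, written additively, and `AddChar G ℂ` is its dual group. -/

section Derived

variable {G : Type u} [AddCommGroup G] [Fintype G]
  {B : Type v} [Ring B] [StarRing B] [Algebra ℂ B] [StarModule ℂ B]
  (ψ : B →ₗ[ℂ] ℂ) (α : AddChar G ℂ →* (B ≃⋆ₐ[ℂ] B))

/-- `A = (A_g)` is a voltage quantum graph on the quantum set `(B, ψ)` with respect to the action
`α` of the dual group on `(B, ψ)`. -/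
structure IsVoltageQuantumGraph (A : G → B →ₗ[ℂ] B) : Prop where
  quantumSet : IsQuantumSet ψ
  action : ∀ χ b, ψ (α χ b) = ψ b
  adjacency : ∀ g, IsQuantumAdjacencyMatrix ψ (A g)
  commute : ∀ g χ b, A g (α χ b) = α χ (A g b)

/-- The map `X_g = (1/n) ∑ χ, conj (χ g) u_χ u_χ†` on the crossed product, where `u_χ†` is the
functional `b ↦ ⟨u_χ, b⟩`. -/
noncomputable def graphX (g : G) : CrossedProduct α →ₗ[ℂ] CrossedProduct α :=
  (1 / (Fintype.card G : ℂ)) • ∑ χ : AddChar G ℂ,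
    conj (χ g) • (gns (CrossedProduct.functional α ψ) (CrossedProduct.u χ)).smulRight
      (CrossedProduct.u χ)

/-- The derived quantum graph `∑ g, m (X_g ⊗ E* A_g E) m*` on the crossed product quantum set. -/
noncomputable def derivedQuantumGraph (A : G → B →ₗ[ℂ] B) :
    CrossedProduct α →ₗ[ℂ] CrossedProduct α :=
  ∑ g, schur (CrossedProduct.functional α ψ) (graphX ψ α g)
    (adjoint (gns (CrossedProduct.functional α ψ)) (gns ψ) (CrossedProduct.expect α) ∘ₗ
      A g ∘ₗ CrossedProduct.expect α)

end Derived

/-! ### Classical graphs -/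

/-- Directed multigraphs (loops and parallel edges allowed) with vertex set `V` and edge set `E`. -/
structure MultiDigraph (V : Type u) (E : Type v) where
  src : E → V
  tgt : E → V

/-- The adjacency matrix as a linear map on `ℂ^V`: the indicator function `e_v` is sent to
`∑ e_w`, summed over all edges `v → w`. -/
def MultiDigraph.adjacencyMap {V : Type u} {E : Type v} [DecidableEq V] [Fintype E]
    (Γ : MultiDigraph V E) : (V → ℂ) →ₗ[ℂ] (V → ℂ) where
  toFun f w := ∑ e, if Γ.tgt e = w then f (Γ.src e) else 0
  map_add' f f' := by
    ext w; simp [← Finset.sum_add_distrib, ← ite_add_zero]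
  map_smul' c f := by
    ext w; simp [Finset.mul_sum]

/-- The functional `ψ_V (f) = ∑ v, f v` on `ℂ^V`. -/
def classicalFunctional (V : Type u) [Fintype V] : (V → ℂ) →ₗ[ℂ] ℂ where
  toFun f := ∑ v, f v
  map_add' f f' := by simp [Finset.sum_add_distrib]
  map_smul' c f := by simp [Finset.mul_sum]

/-- Voltage graphs: directed multigraphs with edges labeled by elements of the group `G`. -/
structure VoltageGraph (V : Type u) (E : Type v) (G : Type w) extends MultiDigraph V E where
  label : E → G

namespace VoltageGraph

variable {V : Type u} {E : Type v} {G : Type w}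

/-- Between any two vertices there is at most one edge with a given label. -/
def IsPreSimple (Γ : VoltageGraph V E G) : Prop :=
  ∀ e f, Γ.src e = Γ.src f → Γ.tgt e = Γ.tgt f → Γ.label e = Γ.label f → e = f

/-- The right derived graph `Γ^λ`: an edge `e : u → v` and `g ∈ G` give an edge
`(e, g) : (u, g) → (v, g + λ(e))`. -/
def derivedGraph [Add G] (Γ : VoltageGraph V E G) : MultiDigraph (V × G) (E × G) where
  src p := (Γ.src p.1, p.2)
  tgt p := (Γ.tgt p.1, p.2 + Γ.label p.1)

/-- The subgraph of all edges with label `g`. -/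
def labeled (Γ : VoltageGraph V E G) (g : G) : MultiDigraph V {e : E // Γ.label e = g} where
  src e := Γ.src e
  tgt e := Γ.tgt e

/-- The family of the adjacency matrices of the subgraphs of equally labeled edges. -/
def adjacencyFamily [DecidableEq V] [DecidableEq G] [Fintype E] (Γ : VoltageGraph V E G) (g : G) :
    (V → ℂ) →ₗ[ℂ] (V → ℂ) :=
  (Γ.labeled g).adjacencyMap

/-- The set of edges with label `g`, as pairs (starting vertex, terminal vertex). -/
def edgeSet (Γ : VoltageGraph V E G) (g : G) : Set (V × V) :=
  {p | ∃ e, Γ.label e = g ∧ Γ.src e = p.1 ∧ Γ.tgt e = p.2}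

/-- The action `α` on the vertices leaves each set of equally labeled edges invariant. -/
def IsInvariant {K : Type*} [Group K] (Γ : VoltageGraph V E G) (α : K →* Equiv.Perm V) : Prop :=
  ∀ χ g, Prod.map (α χ) (α χ) '' Γ.edgeSet g = Γ.edgeSet g

end VoltageGraph

/-- The action on `ℂ^V` induced by an action on `V`: the indicator function `e_v` is sent to
`e_{α_χ v}`. -/
def permAction {K : Type*} [Group K] {V : Type u} (α : K →* Equiv.Perm V) :
    K →* ((V → ℂ) ≃⋆ₐ[ℂ] (V → ℂ)) where
  toFun χ :=
    { toFun := fun f v => f ((α χ)⁻¹ v)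
      invFun := fun f v => f (α χ v)
      left_inv := fun f => by ext v; simp
      right_inv := fun f => by ext v; simp
      map_mul' := fun _ _ => rfl
      map_add' := fun _ _ => rfl
      map_star' := fun _ => rfl
      map_smul' := fun _ _ => rfl }
  map_one' := by ext f v; simp
  map_mul' χ ξ := by ext f v; simp

end QGraph

namespace QGraph

/-! ### Orthogonal bases -/

section OrthogonalBases

variable {M N ι κ : Type*} [AddCommGroup M] [Module ℂ M] [AddCommGroup N] [Module ℂ N]
  [DecidableEq ι] [DecidableEq κ]

/-! Fourier transform in the group variable makes the two quantum graphs look alike. Write n = |G|,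
α̂ for the induced action on ℂ^V, and f ⊗ ξ for the function (v, g) ↦ f(v) ξ(g), with ξ a character.

The elements e_v ⊗ ξ form an orthogonal basis of ℂ^(V×G), the elements e_v u_ξ one of the crossed
product, and every basis vector has squared norm n. In these bases both adjacency maps are diagonal
in ξ and act on f by the same operator Â_ξ = ∑_g conj(ξ(g)) A_g, where A_g is the adjacency map of
the edges labeled g: f ⊗ ξ ↦ Â_ξ f ⊗ ξ (`derivedGraph_adjacencyMap_tmulChar`) and f u_ξ ↦ (Â_ξ f)
u_ξ (`derivedQuantumGraph_singleₗ`).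

The linear map f ⊗ ξ ↦ f u_ξ need not be multiplicative, since u_ξ f = α̂_ξ(f) u_ξ. A matrix leg on
H = ℓ²(Ĝ) removes the twist: put π(f) = ∑_χ α̂_χ(f) ⊗ E_{χ,χ}, and let λ_ξ be translation by ξ. Then
π(f) commutes with u_ξ ⊗ λ_ξ, so ρ(f ⊗ ξ) = π(f)(u_ξ ⊗ λ_ξ) = ∑_χ α̂_χ(f) u_ξ ⊗ E_{χ,ξ⁻¹χ} is a
unital *-homomorphism (`isoOn_mul_isoOn`, `isoOn_one`, `star_isoOn`). The induced map on Hilbert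
spaces carries one orthogonal basis bijectively onto the other, hence is unitary
(`isQuantumSetIso_isoHom`). Invariance of the labeled edge sets makes A_g commute with α̂, so ρ
intertwines the two graphs.

For the quantum graph axioms, m* has an explicit form for a tracial functional with an orthogonal
basis (`IsOrthogonalBasis.comul_apply`). Schur idempotence of the derived quantum graph then follows
from orthogonality of characters. -/

theorem adjoint_eq {F : Sesq M} {F' : Sesq N} {T : M →ₗ[ℂ] N} {S : N →ₗ[ℂ] M}
    (hF : ∀ y, (∀ x, F x y = 0) → y = 0) (h : IsAdjoint F F' T S) : adjoint F F' T = S := by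
  have hex : ∃ S, IsAdjoint F F' T S := ⟨S, h⟩
  ext y
  rw [adjoint, dif_pos hex, ← sub_eq_zero]
  refine hF _ fun x => ?_
  rw [map_sub, ← hex.choose_spec x y, ← h x y, sub_self]

/-- An orthogonal basis all of whose elements have squared norm `c`. -/
def IsOrthogonalBasis (F : Sesq M) (c : ℂ) (b : Module.Basis ι ℂ M) : Prop :=
  ∀ i j, F (b i) (b j) = if i = j then c else 0

namespace IsOrthogonalBasis

variable {F : Sesq M} {F' : Sesq N} {c c' : ℂ} {b : Module.Basis ι ℂ M}
  {b' : Module.Basis κ ℂ N}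

theorem apply_left [Fintype ι] (h : IsOrthogonalBasis F c b) (i : ι) (y : M) :
    F (b i) y = c * b.repr y i := by
  conv_lhs => rw [← b.sum_repr y]
  simp only [map_sum, map_smul, h i]
  simp [mul_comm]

theorem apply [Fintype ι] (h : IsOrthogonalBasis F c b) (x y : M) :
    F x y = c * ∑ i, conj (b.repr x i) * b.repr y i := by
  conv_lhs => rw [← b.sum_repr x]
  simp only [map_sum, LinearMap.map_smulₛₗ, LinearMap.sum_apply, LinearMap.smul_apply, h.apply_left]
  simp [Finset.mul_sum, mul_left_comm]

theorem nondegenerate [Fintype ι] (h : IsOrthogonalBasis F c b) (hc : c ≠ 0) (y : M)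
    (hy : ∀ x, F x y = 0) : y = 0 := by
  refine b.ext_elem fun i => ?_
  have := hy (b i)
  rw [h.apply_left] at this
  simpa [hc] using this

theorem tensor (h : IsOrthogonalBasis F c b) (h' : IsOrthogonalBasis F' c' b') :
    IsOrthogonalBasis (tensorForm F F') (c * c') (b.tensorProduct b') := by
  rintro ⟨i, i'⟩ ⟨j, j'⟩
  simp only [Module.Basis.tensorProduct_apply, tensorForm_tmul, h i j, h' i' j', Prod.mk.injEq]
  split_ifs <;> simp_all

/-- A linear map that permutes orthogonal bases is unitary. -/
theorem isUnitary [Fintype ι] [Fintype κ] (h : IsOrthogonalBasis F c b)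
    (h' : IsOrthogonalBasis F' c b') (σ : ι ≃ κ) {T : M →ₗ[ℂ] N}
    (hT : ∀ i, T (b i) = b' (σ i)) : IsUnitary F F' T := by
  have hT' : T = (b.equiv b' σ : M →ₗ[ℂ] N) := b.ext fun i => by simp [hT]
  subst hT'
  refine ⟨(b.equiv b' σ).bijective, fun x y => ?_⟩
  rw [h.apply]
  conv_lhs => rw [← b.sum_repr x, ← b.sum_repr y]
  simp only [map_sum, LinearMap.map_smulₛₗ, LinearMap.sum_apply, LinearMap.smul_apply, hT, h' _ _,
    σ.injective.eq_iff]
  simp [Finset.mul_sum, mul_comm, mul_left_comm]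

end IsOrthogonalBasis

end OrthogonalBases

/-! ### Quantum sets from orthogonal bases -/

section QuantumSets

variable {B : Type*} [Ring B] [StarRing B] [Algebra ℂ B] [StarModule ℂ B]

/-- A faithful positive functional gives a C*-norm, through left multiplication on the associated
Hilbert space. -/
theorem isFinDimCStarAlgebra_of_faithful [FiniteDimensional ℂ B] (ψ : B →ₗ[ℂ] ℂ)
    (hherm : ∀ a, ψ (star a) = conj (ψ a)) (hpos : ∀ a, 0 ≤ ψ (star a * a))
    (hfaith : ∀ a, ψ (star a * a) = 0 → a = 0) : IsFinDimCStarAlgebra B := by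
  refine ⟨inferInstance, ?_⟩
  let core : InnerProductSpace.Core ℂ B :=
    { inner := fun a b => ψ (star a * b)
      conj_inner_symm := fun a b => by rw [← hherm]; simp
      re_inner_nonneg := fun a => (Complex.le_def.1 (hpos a)).1
      add_left := fun a b d => by simp [add_mul]
      smul_left := fun a b r => by simp
      definite := hfaith }
  let _ : NormedAddCommGroup B := core.toNormedAddCommGroup
  let _ : InnerProductSpace ℂ B := InnerProductSpace.ofCore core.toCore
  have _ : CompleteSpace B := FiniteDimensional.complete ℂ B
  have hinner : ∀ a b : B, inner ℂ a b = ψ (star a * b) := fun _ _ => rfl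
  let L : B → B →L[ℂ] B := fun a => LinearMap.toContinuousLinearMap (LinearMap.mulLeft ℂ a)
  have hL : ∀ a b, L a b = a * b := fun _ _ => rfl
  have hadd : ∀ a b, L (a + b) = L a + L b := fun a b => by ext x; simp [hL, add_mul]
  have hneg : ∀ a, L (-a) = -L a := fun a => by ext x; simp [hL]
  have hzero : L 0 = 0 := by ext x; simp [hL]
  have hmul : ∀ a b, L (a * b) = L a ∘L L b := fun a b => by ext x; simp [hL, mul_assoc]
  have hsmul : ∀ (r : ℂ) a, L (r • a) = r • L a := fun r a => by ext x; simp [hL]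
  have hstar : ∀ a, L (star a) = ContinuousLinearMap.adjoint (L a) := fun a => by
    rw [ContinuousLinearMap.eq_adjoint_iff]
    intro x y
    simp [hL, hinner, mul_assoc]
  let N : AlgebraNorm ℂ B :=
    { toFun := fun a => ‖L a‖
      map_zero' := by simp [hzero]
      add_le' := fun a b => by rw [hadd]; exact norm_add_le _ _
      neg' := fun a => by rw [hneg]; exact norm_neg _
      mul_le' := fun a b => by rw [hmul]; exact ContinuousLinearMap.opNorm_comp_le _ _
      eq_zero_of_map_eq_zero' := fun a ha => by
        rw [← mul_one a, ← hL, norm_eq_zero.1 ha]; rfl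
      smul' := fun r a => by rw [hsmul]; exact norm_smul _ _ }
  refine ⟨N, fun a => ?_⟩
  change ‖L (star a * a)‖ = ‖L a‖ ^ 2
  rw [hmul, hstar, ContinuousLinearMap.norm_adjoint_comp_self, sq]

variable {ι : Type*} [Fintype ι] [DecidableEq ι] {ψ : B →ₗ[ℂ] ℂ} {c : ℂ}
  {b : Module.Basis ι ℂ B}

/-- Pair the right-hand side with a ⊗ d. Traciality turns ψ(a* x b_i*) into ⟨b_i, a* x⟩, which is c
times the i-th coordinate of a* x. Summing these against ψ(d* b_i) reassembles ψ(d* a* x) = ⟨ad, x⟩.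
-/
theorem IsOrthogonalBasis.comul_apply (h : IsOrthogonalBasis (gns ψ) c b) (hc : c ≠ 0)
    (htr : ∀ x y, ψ (x * y) = ψ (y * x)) (x : B) :
    comul ψ x = c⁻¹ • ∑ i, (x * star (b i)) ⊗ₜ[ℂ] b i := by
  let S : B →ₗ[ℂ] B ⊗[ℂ] B :=
    c⁻¹ • ∑ i, (TensorProduct.mk ℂ B B).flip (b i) ∘ₗ LinearMap.mulRight ℂ (star (b i))
  have hS : ∀ y, S y = c⁻¹ • ∑ i, (y * star (b i)) ⊗ₜ[ℂ] b i := fun y => by simp [S]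
  rw [← hS]
  refine LinearMap.congr_fun (adjoint_eq
    ((h.tensor h).nondegenerate (mul_ne_zero hc hc)) fun z y => ?_) x
  induction z using TensorProduct.induction_on with
  | zero => simp
  | add z w hz hw => rw [map_add, map_add, map_add, LinearMap.add_apply, LinearMap.add_apply, hz,
      hw]
  | tmul a d =>
    have key : ∀ i, ψ (star a * (y * star (b i))) = c * b.repr (star a * y) i := fun i => by
      rw [← h.apply_left, gns_apply, ← mul_assoc, htr]
    have hrepr : star d * (star a * y) = ∑ i, b.repr (star a * y) i • (star d * b i) := by
      conv_lhs => rw [← b.sum_repr (star a * y)]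
      simp only [Finset.mul_sum, mul_smul_comm]
    simp only [hS, map_smul, map_sum, tensorForm_tmul, gns_apply, LinearMap.mul'_apply, star_mul,
      key, mul_assoc, hrepr]
    simp [Finset.mul_sum, hc]

theorem IsOrthogonalBasis.schur_apply (h : IsOrthogonalBasis (gns ψ) c b) (hc : c ≠ 0)
    (htr : ∀ x y, ψ (x * y) = ψ (y * x)) (S T : B →ₗ[ℂ] B) (x : B) :
    schur ψ S T x = c⁻¹ • ∑ i, S (x * star (b i)) * T (b i) := by
  simp [schur, h.comul_apply hc htr]

/-- By the formula for m*, the composite m m* is right multiplication by c⁻¹ ∑ b_i* b_i, so `hone`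
is exactly what m m* = id needs. Positivity and faithfulness are read off from coordinates. -/
theorem IsOrthogonalBasis.isQuantumSet (h : IsOrthogonalBasis (gns ψ) c b) (hc : 0 < c)
    (htr : ∀ x y, ψ (x * y) = ψ (y * x)) (hone : ∑ i, star (b i) * b i = c • (1 : B)) :
    IsQuantumSet ψ := by
  have hsq : ∀ a, ψ (star a * a) = c * ∑ i, conj (b.repr a i) * b.repr a i :=
    fun a => h.apply a a
  have hnn : ∀ a : B, ∀ i, 0 ≤ conj (b.repr a i) * b.repr a i :=
    fun a i => star_mul_self_nonneg _
  have hpos : ∀ a, 0 ≤ ψ (star a * a) := fun a => by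
    rw [hsq]
    exact mul_nonneg hc.le (Finset.sum_nonneg fun i _ => hnn a i)
  have hfaith : ∀ a, ψ (star a * a) = 0 → a = 0 := fun a ha => by
    rw [hsq, mul_eq_zero, or_iff_right hc.ne',
      Finset.sum_eq_zero_iff_of_nonneg fun i _ => hnn a i] at ha
    refine b.ext_elem fun i => ?_
    simpa using ha i (Finset.mem_univ i)
  have hherm : ∀ a, ψ (star a) = conj (ψ a) := fun a => by
    have h₁ := h.apply a 1
    have h₂ := h.apply 1 a
    simp only [gns_apply, mul_one, star_one, one_mul] at h₁ h₂
    have hcc : conj c = c := Complex.conj_eq_iff_im.2 (Complex.pos_iff.1 hc).2.symm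
    rw [h₁, h₂, map_mul, hcc]
    simp [mul_comm]
  have : FiniteDimensional ℂ B := b.finiteDimensional_of_finite
  refine ⟨isFinDimCStarAlgebra_of_faithful ψ hherm hpos hfaith, hpos, hfaith, ?_⟩
  ext x
  simp only [LinearMap.comp_apply, h.comul_apply hc.ne' htr, map_smul, map_sum,
    LinearMap.mul'_apply, mul_assoc, ← Finset.mul_sum, hone]
  simp [hc.ne']

end QuantumSets

/-! ### Classical quantum sets and graphs -/

section Classical

variable {V E : Type*} [Fintype V] [DecidableEq V]

@[simp]
theorem classicalFunctional_apply {V : Type*} [Fintype V] (f : V → ℂ) :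
    classicalFunctional V f = ∑ v, f v := rfl

theorem isOrthogonalBasis_basisFun :
    IsOrthogonalBasis (gns (classicalFunctional V)) 1 (Pi.basisFun ℂ V) := by
  intro i j
  simp [Pi.single_apply, eq_comm]

theorem isQuantumSet_classicalFunctional : IsQuantumSet (classicalFunctional V) := by
  refine isOrthogonalBasis_basisFun.isQuantumSet one_pos (fun x y => by rw [mul_comm]) ?_
  ext w
  simp [Pi.single_apply]

theorem schur_classical_apply (S T : (V → ℂ) →ₗ[ℂ] (V → ℂ)) (f : V → ℂ) :
    schur (classicalFunctional V) S T f = ∑ v, f v • (S (Pi.single v 1) * T (Pi.single v 1)) := by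
  rw [isOrthogonalBasis_basisFun.schur_apply one_ne_zero fun x y => by rw [mul_comm]]
  have : ∀ v, f * star (Pi.single v 1 : V → ℂ) = f v • Pi.single v 1 := fun v => by
    ext w; by_cases hw : w = v <;> simp [hw]
  simp only [Pi.basisFun_apply, this, map_smul, smul_mul_assoc, inv_one, one_smul]

variable [Fintype E]

theorem MultiDigraph.adjacencyMap_apply {V : Type*} [DecidableEq V] (Γ : MultiDigraph V E)
    (f : V → ℂ) (w : V) :
    Γ.adjacencyMap f w = ∑ e, if Γ.tgt e = w then f (Γ.src e) else 0 := rfl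

/-- A digraph without parallel edges is a quantum graph. -/
theorem MultiDigraph.isQuantumAdjacencyMatrix (Γ : MultiDigraph V E)
    (hΓ : ∀ e f, Γ.src e = Γ.src f → Γ.tgt e = Γ.tgt f → e = f) :
    IsQuantumAdjacencyMatrix (classicalFunctional V) Γ.adjacencyMap := by
  refine ⟨?_, fun f => ?_⟩
  · refine (Pi.basisFun ℂ V).ext fun v => ?_
    rw [schur_classical_apply]
    ext w
    simp only [Pi.basisFun_apply, Finset.sum_apply, Pi.smul_apply, Pi.mul_apply, smul_eq_mul,
      Pi.single_apply, ite_mul, one_mul, zero_mul, Finset.sum_ite_eq', Finset.mem_univ, if_true]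
    simp only [Γ.adjacencyMap_apply, Pi.single_apply, Finset.sum_mul_sum]
    refine Finset.sum_congr rfl fun e _ => ?_
    -- The Schur square counts pairs of edges with the same endpoints; without parallel edges only
    -- the diagonal pairs (e, e) remain.
    rw [Finset.sum_eq_single e]
    · split_ifs <;> simp
    · intro f _ hf
      split_ifs with h₁ h₂ h₃ h₄ <;> simp
      exact hf (hΓ f e (h₄.trans h₂.symm) (h₃.trans h₁.symm))
    · simp
  · ext w
    simp only [Pi.star_apply, Γ.adjacencyMap_apply, star_sum]
    refine Finset.sum_congr rfl fun e _ => ?_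
    split_ifs <;> simp

end Classical

end QGraph


namespace QGraph

/-! ### Monomials in crossed products -/

namespace CrossedProduct

section Single

variable {K B : Type*} [Group K] [Ring B] [StarRing B] [Algebra ℂ B]
  {α : K →* (B ≃⋆ₐ[ℂ] B)}

theorem coeff_single [DecidableEq K] (χ : K) (b : B) :
    (single χ b : CrossedProduct α).coeff = Pi.single χ b := by
  simp only [single]
  congr!

variable (α) in
/-- `b ↦ b u_χ` as a linear map. -/
noncomputable def singleₗ (χ : K) : B →ₗ[ℂ] CrossedProduct α where
  toFun b := single χ b
  map_add' a b := by classical ext; simp [coeff_single, Pi.single_add]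
  map_smul' c b := by classical ext; simp [coeff_single, Pi.single_smul]

theorem u_eq_singleₗ (χ : K) : (u χ : CrossedProduct α) = singleₗ α χ 1 := rfl

theorem one_eq_singleₗ : (1 : CrossedProduct α) = singleₗ α 1 1 := rfl

theorem coeff_singleₗ [DecidableEq K] (χ : K) (b : B) :
    (singleₗ α χ b).coeff = Pi.single χ b :=
  coeff_single χ b

variable [Fintype K]

theorem singleₗ_mul_singleₗ (χ ξ : K) (a b : B) :
    singleₗ α χ a * singleₗ α ξ b = singleₗ α (χ * ξ) (a * α χ b) := by
  classical
  ext ζ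
  rw [coeff_mul, Finset.sum_eq_single χ]
  · by_cases h : ζ = χ * ξ
    · simp [coeff_singleₗ, h]
    · have : χ⁻¹ * ζ ≠ ξ := fun h' => h (by rw [← h', mul_inv_cancel_left])
      simp [coeff_singleₗ, h, this]
  · intro η _ h
    simp [coeff_singleₗ, h]
  · simp

omit [Fintype K] in
theorem star_singleₗ (χ : K) (b : B) :
    star (singleₗ α χ b) = singleₗ α χ⁻¹ (α χ⁻¹ (star b)) := by
  classical
  ext ζ
  by_cases h : ζ = χ⁻¹
  · simp [coeff_singleₗ, h]
  · have : ζ⁻¹ ≠ χ := fun h' => h (by rw [← h', inv_inv])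
    simp [coeff_singleₗ, h, this]

theorem functional_apply (ψ : B →ₗ[ℂ] ℂ) (x : CrossedProduct α) :
    functional α ψ x = (Fintype.card K : ℂ) * ψ (x.coeff 1) := rfl

theorem expect_apply (x : CrossedProduct α) :
    expect α x = (Fintype.card K : ℂ) • x.coeff 1 := rfl

/-- The coefficient of xy at 1 is ∑ x_ξ α_ξ(y_{ξ⁻¹}). Its ξ-term matches the ξ⁻¹-term y_{ξ⁻¹}
α_{ξ⁻¹}(x_ξ) of yx after applying α_ξ, which preserves ψ, and swapping the two factors. -/
theorem functional_mul_comm (ψ : B →ₗ[ℂ] ℂ) (htr : ∀ a b, ψ (a * b) = ψ (b * a))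
    (hα : ∀ χ b, ψ (α χ b) = ψ b) (x y : CrossedProduct α) :
    functional α ψ (x * y) = functional α ψ (y * x) := by
  simp only [functional_apply, coeff_mul, map_sum]
  congr 1
  refine Fintype.sum_equiv (Equiv.inv K) _ _ fun ξ => ?_
  rw [← hα ξ (y.coeff (Equiv.inv K ξ) * _), htr, map_mul (α ξ), ← StarAlgEquiv.mul_apply,
    ← map_mul α]
  simp

end Single

end CrossedProduct

/-! ### The crossed product of `ℂ^V` -/

section PermCrossedProduct

variable {K V : Type*} [Group K]

@[simp]
theorem permAction_apply (α : K →* Equiv.Perm V) (χ : K) (f : V → ℂ) (v : V) :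
    permAction α χ f v = f ((α χ)⁻¹ v) := rfl

theorem permAction_single [DecidableEq V] (α : K →* Equiv.Perm V) (χ : K) (v : V) :
    permAction α χ (Pi.single v 1) = Pi.single (α χ v) 1 := by
  ext w
  simp only [permAction_apply, Pi.single_apply, Equiv.Perm.inv_eq_iff_eq]

theorem classicalFunctional_permAction [Fintype V] (α : K →* Equiv.Perm V) (χ : K) (f : V → ℂ) :
    classicalFunctional V (permAction α χ f) = classicalFunctional V f :=
  Equiv.sum_comp (α χ)⁻¹ f

theorem linearMap_apply_eq_sum [Fintype V] [DecidableEq V] {M : Type*} [AddCommGroup M]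
    [Module ℂ M] (T : (V → ℂ) →ₗ[ℂ] M) (f : V → ℂ) : T f = ∑ v, f v • T (Pi.single v 1) := by
  conv_lhs => rw [← (Pi.basisFun ℂ V).sum_repr f]
  simp

variable [Fintype V] [DecidableEq V] [Fintype K] [DecidableEq K] (α : K →* Equiv.Perm V)

open CrossedProduct

/-- The basis of the elements `e_v u_χ`. -/
noncomputable def crossedBasis : Module.Basis (V × K) ℂ (CrossedProduct (permAction α)) :=
  ((Pi.basis fun _ : K => Pi.basisFun ℂ V).map
    { toFun := fun f => ⟨f⟩
      invFun := fun x => x.coeff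
      map_add' := fun _ _ => rfl
      map_smul' := fun _ _ => rfl }).reindex
    ((Equiv.sigmaEquivProd K V).trans (Equiv.prodComm K V))

theorem crossedBasis_apply (v : V) (χ : K) :
    crossedBasis α (v, χ) = singleₗ (permAction α) χ (Pi.single v 1) := by
  ext : 1
  rw [coeff_singleₗ]
  simp [crossedBasis]

/-- The product (e_v u_χ)* (e_w u_ξ) equals α̂_{χ⁻¹}(e_v e_w) u_{χ⁻¹ξ}, whose coefficient at 1
vanishes unless χ = ξ and v = w. The squared norm is the factor n in the functional. -/
theorem isOrthogonalBasis_crossedBasis :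
    IsOrthogonalBasis (gns (functional (permAction α) (classicalFunctional V)))
      (Fintype.card K) (crossedBasis α) := by
  rintro ⟨v, χ⟩ ⟨w, ξ⟩
  rw [crossedBasis_apply, crossedBasis_apply, gns_apply, star_singleₗ, singleₗ_mul_singleₗ,
    functional_apply, coeff_singleₗ, ← map_mul]
  by_cases h : χ = ξ
  · subst h
    rw [inv_mul_cancel, Pi.single_eq_same, classicalFunctional_permAction]
    simp [Pi.single_apply, eq_comm]
  · have : (1 : K) ≠ χ⁻¹ * ξ := fun h' => h (inv_mul_eq_one.1 h'.symm)
    simp [this, h]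

omit [DecidableEq V] [DecidableEq K] in
theorem functional_perm_mul_comm (x y : CrossedProduct (permAction α)) :
    functional (permAction α) (classicalFunctional V) (x * y) =
      functional (permAction α) (classicalFunctional V) (y * x) :=
  functional_mul_comm _ (fun a b => by rw [mul_comm]) (classicalFunctional_permAction α) x y

omit [DecidableEq K] in
theorem isQuantumSet_crossedProduct :
    IsQuantumSet (functional (permAction α) (classicalFunctional V)) := by
  classical
  refine (isOrthogonalBasis_crossedBasis α).isQuantumSet (by exact_mod_cast Fintype.card_pos)
    (functional_perm_mul_comm α) ?_
  have hone : ∑ v : V, (Pi.single v 1 : V → ℂ) = 1 := by ext w; simp [Pi.single_apply]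
  rw [Fintype.sum_prod_type_right]
  simp only [crossedBasis_apply, star_singleₗ, singleₗ_mul_singleₗ, ← map_mul, inv_mul_cancel,
    ← map_sum]
  have hsq : ∀ v : V, star (Pi.single v 1 : V → ℂ) * Pi.single v 1 = Pi.single v 1 := fun v => by
    ext w; by_cases h : w = v <;> simp [h]
  simp only [hsq, hone, map_one, one_eq_singleₗ, Finset.sum_const, Finset.card_univ,
    Nat.cast_smul_eq_nsmul, map_nsmul]

/-- Insert the basis e_w u_χ into the formula for m*: f u_ξ (e_w u_χ)* = f e_v u_{ξχ⁻¹} with v =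
ξχ⁻¹ · w. Summing over v instead of w lets f e_v collapse to f(v) e_v. -/
theorem schur_crossed_apply
    (S T : CrossedProduct (permAction α) →ₗ[ℂ] CrossedProduct (permAction α))
    (ξ : K) (f : V → ℂ) :
    schur (functional (permAction α) (classicalFunctional V)) S T (singleₗ (permAction α) ξ f) =
      (Fintype.card K : ℂ)⁻¹ • ∑ χ, ∑ v, f v •
        (S (singleₗ (permAction α) (ξ * χ⁻¹) (Pi.single v 1)) *
          T (singleₗ (permAction α) χ (Pi.single ((α (ξ * χ⁻¹))⁻¹ v) 1))) := by
  rw [(isOrthogonalBasis_crossedBasis α).schur_apply (by exact_mod_cast Fintype.card_ne_zero)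
    (functional_perm_mul_comm α), Fintype.sum_prod_type_right]
  congr 1
  refine Finset.sum_congr rfl fun χ _ => ?_
  refine Fintype.sum_equiv (α (ξ * χ⁻¹)) _ _ fun v => ?_
  have hstar : star (Pi.single v 1 : V → ℂ) = Pi.single v 1 := by
    ext w; by_cases h : w = v <;> simp [h]
  have hmul : ∀ w, f * Pi.single w 1 = f w • (Pi.single w 1 : V → ℂ) := fun w => by
    ext x; by_cases h : x = w <;> simp [h]
  rw [crossedBasis_apply, star_singleₗ, singleₗ_mul_singleₗ, hstar, ← StarAlgEquiv.mul_apply,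
    ← map_mul, permAction_single, hmul, map_smul, map_smul, smul_mul_assoc,
    Equiv.Perm.coe_inv, Equiv.symm_apply_apply]

/-- The factor n in E is the same as the one in the functional, so the adjoint is the unscaled
inclusion f ↦ f u_1. -/
theorem adjoint_expect :
    adjoint (gns (functional (permAction α) (classicalFunctional V))) (gns (classicalFunctional V))
      (expect (permAction α)) = singleₗ (permAction α) 1 := by
  refine adjoint_eq ((isOrthogonalBasis_crossedBasis α).nondegenerate
    (by exact_mod_cast Fintype.card_ne_zero)) fun x f => ?_
  have hcoeff : (star x * singleₗ (permAction α) 1 f).coeff 1 = star (x.coeff 1) * f := by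
    rw [coeff_mul, Finset.sum_eq_single 1]
    · simp [coeff_singleₗ]
    · intro ξ _ h
      simp [coeff_singleₗ, h]
    · simp
  rw [gns_apply, gns_apply, functional_apply, hcoeff, expect_apply]
  simp

end PermCrossedProduct

/-! ### The derived quantum graph -/

section Derived

open CrossedProduct

variable {G V : Type*} [AddCommGroup G] [Fintype G] [Fintype V] [DecidableEq V]
  (α : AddChar G ℂ →* Equiv.Perm V)

theorem card_addChar_ne_zero : (Fintype.card (AddChar G ℂ) : ℂ) ≠ 0 := by
  exact_mod_cast Fintype.card_ne_zero

theorem conj_inv_apply (χ : AddChar G ℂ) (g : G) : conj (χ⁻¹ g) = χ g := by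
  rw [← AddChar.map_neg_eq_conj, AddChar.inv_apply, neg_neg]

omit [DecidableEq V] in
-- Since ⟨u_χ, f u_ξ⟩ is n ψ(f) for χ = ξ and 0 otherwise, X_g keeps the mode ξ, weights it by
-- conj(ξ(g)) and replaces its coefficient by the scalar ψ(f).
theorem graphX_singleₗ (g : G) (ξ : AddChar G ℂ) (f : V → ℂ) :
    graphX (classicalFunctional V) (permAction α) g (singleₗ (permAction α) ξ f) =
      singleₗ (permAction α) ξ ((conj (ξ g) * classicalFunctional V f) • 1) := by
  classical
  have hne := card_addChar_ne_zero (G := G)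
  -- The 1/n in X_g counts G, while the n in the functional counts the dual group; they must agree
  -- to cancel.
  have hn : (Fintype.card G : ℂ) = Fintype.card (AddChar G ℂ) := by rw [AddChar.card_eq]
  simp only [graphX, hn, LinearMap.smul_apply, LinearMap.sum_apply, LinearMap.smulRight_apply,
    u_eq_singleₗ, gns_apply, star_singleₗ, singleₗ_mul_singleₗ, functional_apply, star_one, map_one,
    one_mul, coeff_singleₗ]
  rw [Finset.sum_eq_single ξ]
  · rw [inv_mul_cancel, Pi.single_eq_same, classicalFunctional_permAction, map_smul, smul_smul,
      smul_smul]
    congr 1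
    field_simp
  · intro χ _ h
    have : (1 : AddChar G ℂ) ≠ χ⁻¹ * ξ := fun h' => h (inv_mul_eq_one.1 h'.symm)
    simp [this]
  · simp

variable {A : G → (V → ℂ) →ₗ[ℂ] (V → ℂ)}

/-- E sees only the coefficient at 1, so among the splittings ξ = (ξχ⁻¹)χ in the Schur product only
χ = 1 survives. The first leg then contributes conj(ξ(g)) u_ξ, and moving u_ξ past A_g(α̂_ξ⁻¹ e_v)
gives A_g(e_v) u_ξ by commutation. The n in E cancels the n⁻¹ in m*. -/
theorem derivedQuantumGraph_singleₗ
    (hcomm : ∀ g χ f, A g (permAction α χ f) = permAction α χ (A g f))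
    (ξ : AddChar G ℂ) (f : V → ℂ) :
    derivedQuantumGraph (classicalFunctional V) (permAction α) A (singleₗ (permAction α) ξ f) =
      singleₗ (permAction α) ξ (∑ g, conj (ξ g) • A g f) := by
  classical
  rw [derivedQuantumGraph, LinearMap.sum_apply, map_sum]
  refine Finset.sum_congr rfl fun g _ => ?_
  rw [schur_crossed_apply, adjoint_expect, Finset.sum_eq_single 1]
  · have hψ : ∀ v : V, classicalFunctional V (Pi.single v 1) = 1 := fun v => by simp
    simp only [inv_one, mul_one, graphX_singleₗ, LinearMap.comp_apply, expect_apply, coeff_singleₗ,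
      Pi.single_eq_same, singleₗ_mul_singleₗ, hψ]
    rw [linearMap_apply_eq_sum (A g) f]
    simp only [← map_smul (singleₗ (permAction α) ξ), ← map_sum (singleₗ (permAction α) ξ)]
    congr 1
    simp only [Finset.smul_sum, map_smul, ← hcomm, permAction_single, Equiv.Perm.coe_inv,
      Equiv.apply_symm_apply]
    refine Finset.sum_congr rfl fun v _ => ?_
    simp only [smul_mul_assoc, mul_smul_comm, one_mul, smul_smul]
    congr 1
    field_simp [card_addChar_ne_zero]
  · intro χ _ h
    refine Finset.sum_eq_zero fun v _ => ?_
    simp [expect_apply, coeff_singleₗ, h.symm]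
  · simp

/-- At e_v u_ξ the Schur square is the average over χ of ∑_{g,h} conj(ξ(g)) χ(g - h) (A_g e_v)(A_h
e_v) u_ξ. Orthogonality of characters leaves g = h, where Schur idempotence of A_g finishes. -/
theorem derivedQuantumGraph_isQuantumGraph
    (hcomm : ∀ g χ f, A g (permAction α χ f) = permAction α χ (A g f))
    (hA : ∀ g, IsQuantumAdjacencyMatrix (classicalFunctional V) (A g)) :
    IsQuantumGraph (functional (permAction α) (classicalFunctional V))
      (derivedQuantumGraph (classicalFunctional V) (permAction α) A) := by
  classical
  refine ⟨isQuantumSet_crossedProduct α, ?_, fun x => ?_⟩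
  · refine (crossedBasis α).ext fun ⟨v, ξ⟩ => ?_
    have hsum : ∀ χ g h, conj (χ h) * conj ((ξ * χ⁻¹) g) = conj (ξ g) * χ (g - h) :=
      fun χ g h => by
        rw [mul_comm, AddChar.mul_apply, map_mul, conj_inv_apply, AddChar.map_sub_eq_div,
          ← AddChar.map_neg_eq_conj χ, AddChar.map_neg_eq_inv, mul_assoc, div_eq_mul_inv]
    rw [crossedBasis_apply, schur_crossed_apply, derivedQuantumGraph_singleₗ α hcomm]
    simp only [derivedQuantumGraph_singleₗ α hcomm, singleₗ_mul_singleₗ, inv_mul_cancel_right,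
      ← map_smul (singleₗ (permAction α) ξ), ← map_sum (singleₗ (permAction α) ξ)]
    congr 1
    -- Evaluated at e_v, Schur idempotence of A_g says that the function A_g e_v is its own square.
    have hidem : ∀ g, A g (Pi.single v 1) * A g (Pi.single v 1) = A g (Pi.single v 1) := fun g => by
      have := LinearMap.congr_fun (hA g).schur_idem (Pi.single v 1)
      rwa [schur_classical_apply, Finset.sum_eq_single v (fun w _ hw => by simp [hw]) (by simp),
        Pi.single_eq_same, one_smul] at this
    have hterm : ∀ χ, ∑ w, (Pi.single v 1 : V → ℂ) w •
        ((∑ g, conj ((ξ * χ⁻¹) g) • A g (Pi.single w 1)) *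
          permAction α (ξ * χ⁻¹) (∑ h, conj (χ h) •
            A h (Pi.single ((α (ξ * χ⁻¹))⁻¹ w) 1))) =
        ∑ g, ∑ h, (conj (ξ g) * χ (g - h)) • (A g (Pi.single v 1) * A h (Pi.single v 1)) :=
      fun χ => by
        rw [Finset.sum_eq_single v (fun w _ hw => by simp [hw]) (by simp), Pi.single_eq_same,
          one_smul, map_sum, Finset.sum_mul_sum]
        simp only [map_smul, ← hcomm, permAction_single, Equiv.Perm.coe_inv,
          Equiv.apply_symm_apply, smul_mul_assoc, mul_smul_comm, smul_smul, ← hsum]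
    simp only [hterm]
    rw [Finset.sum_comm, Finset.smul_sum]
    refine Finset.sum_congr rfl fun g _ => ?_
    rw [Finset.sum_comm, Finset.sum_eq_single g]
    · simp only [sub_self, AddChar.map_zero_eq_one, mul_one, hidem, Finset.sum_const,
        Finset.card_univ, ← Nat.cast_smul_eq_nsmul ℂ, smul_smul]
      congr 1
      field_simp [card_addChar_ne_zero]
    · intro h _ hgh
      rw [← Finset.sum_smul, ← Finset.mul_sum, AddChar.sum_apply_eq_ite,
        if_neg (sub_ne_zero.2 hgh.symm), mul_zero, zero_smul]
    · simp
  · rw [← (crossedBasis α).sum_repr x]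
    simp only [star_sum, star_smul, map_sum, map_smul]
    refine Finset.sum_congr rfl fun ⟨v, ξ⟩ _ => ?_
    congr 1
    rw [crossedBasis_apply, star_singleₗ, derivedQuantumGraph_singleₗ α hcomm,
      derivedQuantumGraph_singleₗ α hcomm, star_singleₗ]
    simp only [star_sum, star_smul, map_sum, map_smul, hcomm, (hA _).star_preserving,
      conj_inv_apply]
    simp

end Derived

end QGraph


namespace QGraph

/-! ### Matrix units on the Hilbert space with a given finite orthonormal basis -/

section MatrixUnits

variable (K : Type*) [Fintype K]

/-- A Hilbert space (in the lowest universe) with an orthonormal basis indexed by `K`. -/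
abbrev HilbertSpan : Type := EuclideanSpace ℂ (Fin (Fintype.card K))

/-- The orthonormal basis of `HilbertSpan K`. -/
noncomputable def hilbertBasis : Module.Basis K ℂ (HilbertSpan K) :=
  (EuclideanSpace.basisFun (Fin (Fintype.card K)) ℂ).toBasis.reindex (Fintype.equivFin K).symm

variable {K} in
/-- The matrix unit that sends the basis vector `η` to the basis vector `χ`. -/
noncomputable def matrixUnit (χ η : K) : HilbertSpan K →L[ℂ] HilbertSpan K :=
  Matrix.toEuclideanCLM (𝕜 := ℂ) (Matrix.single (Fintype.equivFin K χ) (Fintype.equivFin K η) 1)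

theorem hilbertBasis_apply (χ : K) :
    hilbertBasis K χ = EuclideanSpace.single (Fintype.equivFin K χ) 1 := by
  simp [hilbertBasis]

variable [DecidableEq K]

theorem isOrthogonalBasis_hilbertBasis : IsOrthogonalBasis (innerₛₗ ℂ) 1 (hilbertBasis K) := by
  intro χ η
  rw [innerₛₗ_apply_apply, hilbertBasis_apply, hilbertBasis_apply, EuclideanSpace.inner_single_left]
  simp

variable {K}

theorem matrixUnit_apply_hilbertBasis (χ η ζ : K) :
    matrixUnit χ η (hilbertBasis K ζ) = if η = ζ then hilbertBasis K χ else 0 := by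
  ext i
  rw [hilbertBasis_apply, hilbertBasis_apply, matrixUnit, EuclideanSpace.single,
    Matrix.toEuclideanCLM_toLp]
  by_cases h : η = ζ
  · subst h
    simp [Matrix.single_apply, eq_comm]
  · simp [h]

theorem matrixUnit_mul_matrixUnit (χ η η' ζ : K) :
    matrixUnit χ η * matrixUnit η' ζ = if η = η' then matrixUnit χ ζ else 0 := by
  rw [matrixUnit, matrixUnit, ← map_mul]
  by_cases h : η = η'
  · subst h
    simp [matrixUnit]
  · have : Fintype.equivFin K η ≠ Fintype.equivFin K η' := fun h' => h (by simpa using h')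
    simp [Matrix.single_mul_single_of_ne _ _ _ _ this, h]

omit [DecidableEq K] in
theorem star_matrixUnit (χ η : K) : star (matrixUnit χ η) = matrixUnit η χ := by
  rw [matrixUnit, ← map_star, Matrix.star_eq_conjTranspose, Matrix.conjTranspose_single, star_one,
    matrixUnit]

omit [DecidableEq K] in
theorem sum_matrixUnit_self : ∑ χ : K, matrixUnit χ χ = 1 := by
  have h : ∑ i : Fin (Fintype.card K), Matrix.single i i (1 : ℂ) = 1 := by
    ext i j
    simp [Matrix.sum_apply, Matrix.single_apply, Matrix.one_apply, ite_and]
  simp only [matrixUnit]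
  rw [← map_one (Matrix.toEuclideanCLM (𝕜 := ℂ) (n := Fin (Fintype.card K))), ← h, map_sum]
  exact Fintype.sum_equiv (Fintype.equivFin K) _ _ fun _ => rfl

end MatrixUnits

/-! ### Functions on `V × G` -/

section Fourier

variable {V G : Type*} [AddCommGroup G]

variable (V) in
/-- The map `f ↦ f ⊗ ξ` from functions on `V` to functions on `V × G`, for a character `ξ`. -/
def tmulChar (ξ : AddChar G ℂ) : (V → ℂ) →ₗ[ℂ] (V × G → ℂ) where
  toFun f p := f p.1 * ξ p.2
  map_add' f f' := by ext p; simp [add_mul]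
  map_smul' c f := by ext p; simp [mul_assoc]

@[simp]
theorem tmulChar_apply (ξ : AddChar G ℂ) (f : V → ℂ) (p : V × G) :
    tmulChar V ξ f p = f p.1 * ξ p.2 := rfl

theorem tmulChar_mul_tmulChar (ξ η : AddChar G ℂ) (f f' : V → ℂ) :
    tmulChar V ξ f * tmulChar V η f' = tmulChar V (ξ * η) (f * f') := by
  ext p
  simp [mul_mul_mul_comm]

theorem one_eq_tmulChar : (1 : V × G → ℂ) = tmulChar V 1 1 := by
  ext p
  simp

variable [Fintype G]

theorem star_tmulChar (ξ : AddChar G ℂ) (f : V → ℂ) :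
    star (tmulChar V ξ f) = tmulChar V ξ⁻¹ (star f) := by
  ext p
  simp only [Pi.star_apply, tmulChar_apply, star_mul']
  rw [← starRingEnd_apply (ξ p.2), ← conj_inv_apply, Complex.conj_conj]

variable [Fintype V] [DecidableEq V] [DecidableEq (AddChar G ℂ)]

variable (V G) in
/-- The basis of the functions `e_v ⊗ ξ` on `V × G`. -/
noncomputable def charBasis : Module.Basis (V × AddChar G ℂ) ℂ (V × G → ℂ) :=
  ((Pi.basis fun _ : V => AddChar.complexBasis G).map
    { toFun := fun f p => f p.1 p.2
      invFun := fun f v g => f (v, g)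
      map_add' := fun _ _ => rfl
      map_smul' := fun _ _ => rfl }).reindex (Equiv.sigmaEquivProd V (AddChar G ℂ))

omit [DecidableEq (AddChar G ℂ)] in
theorem charBasis_apply (v : V) (ξ : AddChar G ℂ) :
    charBasis V G (v, ξ) = tmulChar V ξ (Pi.single v 1) := by
  ext ⟨w, g⟩
  by_cases h : w = v
  · subst h; simp [charBasis]
  · simp [charBasis, h]

/-- The squared norm n comes from summing |ξ|² = 1 over G. It agrees with that of `crossedBasis`, as
unitarity of the isomorphism requires. -/
theorem isOrthogonalBasis_charBasis :
    IsOrthogonalBasis (gns (classicalFunctional (V × G))) (Fintype.card (AddChar G ℂ))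
      (charBasis V G) := by
  rintro ⟨v, ξ⟩ ⟨w, η⟩
  rw [charBasis_apply, charBasis_apply, gns_apply, star_tmulChar, tmulChar_mul_tmulChar,
    classicalFunctional_apply, Fintype.sum_prod_type]
  simp only [tmulChar_apply, ← Finset.mul_sum, AddChar.sum_eq_ite, AddChar.card_eq]
  -- `AddChar.sum_eq_ite` writes the trivial character as `0`, which is definitionally `1` in the
  -- multiplicative notation.
  have h : ξ⁻¹ * η = 0 ↔ ξ = η := inv_mul_eq_one
  rw [← Finset.sum_mul]
  by_cases h' : ξ = η
  · rw [if_pos (h.2 h')]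
    simp [h', Pi.single_apply, eq_comm]
  · simp [mt h.1 h', h']

end Fourier

/-! ### Voltage graphs -/

namespace VoltageGraph

section Adjacency

variable {V E G : Type*} [Fintype V] [DecidableEq V] [Fintype E] [DecidableEq G]
  {Γ : VoltageGraph V E G}

theorem adjacencyFamily_isQuantumAdjacencyMatrix (hΓ : Γ.IsPreSimple) (g : G) :
    IsQuantumAdjacencyMatrix (classicalFunctional V) (Γ.adjacencyFamily g) :=
  (Γ.labeled g).isQuantumAdjacencyMatrix fun e f hs ht =>
    Subtype.ext (hΓ _ _ hs ht (e.2.trans f.2.symm))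

open Classical in
-- Pre-simplicity makes every multiplicity 0 or 1, so the edge set alone determines the operator.
-- This lets invariance of edge sets give commutation with the action.
theorem adjacencyFamily_apply (hΓ : Γ.IsPreSimple) (g : G) (f : V → ℂ) (w : V) :
    Γ.adjacencyFamily g f w = ∑ v, if (v, w) ∈ Γ.edgeSet g then f v else 0 := by
  have h₁ : ∀ e : {e : E // Γ.label e = g}, (if Γ.tgt e = w then f (Γ.src e) else 0) =
      ∑ v, if Γ.tgt e = w ∧ Γ.src e = v then f v else 0 := fun e => by
    by_cases h : Γ.tgt e = w <;> simp [h]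
  change ∑ e : {e : E // Γ.label e = g}, (if Γ.tgt e = w then f (Γ.src e) else 0) = _
  simp only [h₁]
  rw [Finset.sum_comm]
  refine Finset.sum_congr rfl fun v _ => ?_
  by_cases h : (v, w) ∈ Γ.edgeSet g
  · obtain ⟨e, rfl, hs, ht⟩ := h
    rw [if_pos ⟨e, rfl, hs, ht⟩, Finset.sum_eq_single ⟨e, rfl⟩]
    · exact if_pos ⟨ht, hs⟩
    · intro e' _ he'
      refine if_neg fun h' => he' (Subtype.ext ?_)
      exact hΓ _ _ (h'.2.trans hs.symm) (h'.1.trans ht.symm) e'.2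
    · simp
  · rw [if_neg h]
    exact Finset.sum_eq_zero fun e _ => if_neg fun h' => h ⟨e, e.2, h'.2, h'.1⟩

theorem adjacencyFamily_permAction {K : Type*} [Group K] {α : K →* Equiv.Perm V}
    (hΓ : Γ.IsPreSimple) (hα : Γ.IsInvariant α) (g : G) (χ : K) (f : V → ℂ) :
    Γ.adjacencyFamily g (permAction α χ f) = permAction α χ (Γ.adjacencyFamily g f) := by
  classical
  ext w
  rw [permAction_apply, adjacencyFamily_apply hΓ, adjacencyFamily_apply hΓ]
  refine Fintype.sum_equiv (α χ)⁻¹ _ _ fun v => ?_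
  have hmem : (v, w) ∈ Γ.edgeSet g ↔ ((α χ)⁻¹ v, (α χ)⁻¹ w) ∈ Γ.edgeSet g := by
    conv_lhs => rw [← hα χ g]
    constructor
    · rintro ⟨⟨a, b⟩, hab, h⟩
      obtain ⟨rfl, rfl⟩ := Prod.mk.inj h
      simpa using hab
    · intro h
      exact ⟨_, h, by simp⟩
  simp only [permAction_apply, hmem]

variable [AddCommGroup G] [Fintype G]

omit [Fintype V] in
-- The edge over e ending at (w, h) starts in the fibre coordinate h - λ(e), where ξ takes the value
-- conj(ξ(λ(e))) ξ(h).
theorem derivedGraph_adjacencyMap_tmulChar (ξ : AddChar G ℂ) (f : V → ℂ) :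
    Γ.derivedGraph.adjacencyMap (tmulChar V ξ f) =
      tmulChar V ξ (∑ g, conj (ξ g) • Γ.adjacencyFamily g f) := by
  ext ⟨w, h⟩
  have hL : Γ.derivedGraph.adjacencyMap (tmulChar V ξ f) (w, h) =
      ∑ e, conj (ξ (Γ.label e)) * (if Γ.tgt e = w then f (Γ.src e) else 0) * ξ h := by
    rw [MultiDigraph.adjacencyMap_apply, Fintype.sum_prod_type]
    refine Finset.sum_congr rfl fun e _ => ?_
    rw [Finset.sum_eq_single (h - Γ.label e)]
    · simp only [derivedGraph, sub_add_cancel, Prod.mk.injEq, and_true, tmulChar_apply]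
      rw [sub_eq_add_neg, AddChar.map_add_eq_mul, AddChar.map_neg_eq_conj]
      split_ifs <;> ring
    · intro k _ hk
      refine if_neg fun h' => hk ?_
      rw [← (Prod.mk.inj h').2, add_sub_cancel_right]
    · simp
  -- The edges are grouped by label, so that conj(ξ(g)) is constant on each group.
  rw [hL, tmulChar_apply, ← Finset.sum_mul, Finset.sum_apply,
    ← (Equiv.sigmaFiberEquiv Γ.label).sum_comp, Fintype.sum_sigma]
  congr 1
  refine Finset.sum_congr rfl fun g _ => ?_
  rw [Pi.smul_apply, adjacencyFamily, MultiDigraph.adjacencyMap_apply, smul_eq_mul, Finset.mul_sum]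
  refine Finset.sum_congr rfl fun e _ => ?_
  simp only [Equiv.sigmaFiberEquiv, Equiv.coe_fn_mk, labeled, e.2]
  rfl

theorem derivedGraph_isQuantumGraph (hΓ : Γ.IsPreSimple) :
    IsQuantumGraph (classicalFunctional (V × G)) Γ.derivedGraph.adjacencyMap := by
  refine ⟨isQuantumSet_classicalFunctional, MultiDigraph.isQuantumAdjacencyMatrix _ ?_⟩
  rintro ⟨e, g⟩ ⟨f, h⟩ hs ht
  obtain ⟨hs, rfl⟩ := Prod.mk.inj hs
  obtain ⟨ht, hl⟩ := Prod.mk.inj ht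
  rw [hΓ e f hs ht (add_left_cancel hl)]

end Adjacency

end VoltageGraph

/-! ### The quantum isomorphism -/

section Iso

open CrossedProduct

variable {G V : Type*} [AddCommGroup G] [Fintype G] [Fintype V] [DecidableEq V]
  (α : AddChar G ℂ →* Equiv.Perm V)

theorem tensor_sum_mul_sum {A B ι κ : Type*} [Ring A] [Ring B] [Algebra ℂ A] [Algebra ℂ B]
    (s : Finset ι) (t : Finset κ) (f : ι → A ⊗[ℂ] B) (f' : κ → A ⊗[ℂ] B) :
    (∑ i ∈ s, f i) * ∑ j ∈ t, f' j = ∑ i ∈ s, ∑ j ∈ t, f i * f' j :=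
  Finset.sum_mul_sum s t f f'

theorem tensor_star_sum {A B ι : Type*} [Ring A] [StarRing A] [Algebra ℂ A] [StarModule ℂ A]
    [Ring B] [StarRing B] [Algebra ℂ B] [StarModule ℂ B] (s : Finset ι) (f : ι → A ⊗[ℂ] B) :
    star (∑ i ∈ s, f i) = ∑ i ∈ s, star (f i) :=
  star_sum s f

/-- The image of `f ⊗ ξ` under the quantum isomorphism. -/
noncomputable def isoOn (ξ : AddChar G ℂ) : (V → ℂ) →ₗ[ℂ] CrossedProduct (permAction α) ⊗[ℂ]
    (HilbertSpan (AddChar G ℂ) →L[ℂ] HilbertSpan (AddChar G ℂ)) :=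
  ∑ χ, (TensorProduct.mk ℂ (CrossedProduct (permAction α)) _).flip (matrixUnit χ (ξ⁻¹ * χ)) ∘ₗ
    singleₗ (permAction α) ξ ∘ₗ (permAction α χ : (V → ℂ) ≃⋆ₐ[ℂ] (V → ℂ)).toAlgEquiv.toLinearMap

omit [Fintype V] [DecidableEq V] in
theorem isoOn_apply (ξ : AddChar G ℂ) (f : V → ℂ) :
    isoOn α ξ f = ∑ χ, singleₗ (permAction α) ξ (permAction α χ f) ⊗ₜ[ℂ]
      matrixUnit χ (ξ⁻¹ * χ) := by
  simp [isoOn]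

omit [Fintype V] [DecidableEq V] in
-- Matrix units compose only for ζ = ξ⁻¹χ. Then u_ξ α̂_ζ(f') = α̂_{ξζ}(f') u_ξ = α̂_χ(f') u_ξ, so
-- both functions carry the same twist α̂_χ.
theorem isoOn_mul_isoOn (ξ η : AddChar G ℂ) (f f' : V → ℂ) :
    isoOn α ξ f * isoOn α η f' = isoOn α (ξ * η) (f * f') := by
  classical
  simp only [isoOn_apply, tensor_sum_mul_sum, Algebra.TensorProduct.tmul_mul_tmul,
    matrixUnit_mul_matrixUnit, singleₗ_mul_singleₗ, ← StarAlgEquiv.mul_apply, ← map_mul]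
  refine Finset.sum_congr rfl fun χ _ => ?_
  rw [Finset.sum_eq_single (ξ⁻¹ * χ)]
  · rw [if_pos rfl, mul_inv_cancel_left, ← map_mul, mul_inv_rev, mul_assoc]
  · intro ζ _ h
    rw [if_neg h.symm, TensorProduct.tmul_zero]
  · simp

omit [Fintype V] [DecidableEq V] in
theorem isoOn_one : isoOn α 1 1 = 1 := by
  classical
  simp only [isoOn_apply, map_one, inv_one, one_mul, ← TensorProduct.tmul_sum,
    sum_matrixUnit_self, ← one_eq_singleₗ]
  rfl

omit [DecidableEq V] in
theorem star_isoOn (ξ : AddChar G ℂ) (f : V → ℂ) :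
    star (isoOn α ξ f) = isoOn α ξ⁻¹ (star f) := by
  classical
  simp only [isoOn_apply, tensor_star_sum, TensorProduct.star_tmul, star_matrixUnit, star_singleₗ,
    ← map_star, ← StarAlgEquiv.mul_apply, ← map_mul, inv_inv]
  -- The adjoint of α̂_χ(f) u_ξ ⊗ E_{χ,ξ⁻¹χ} is the summand for f* and ξ⁻¹ with index ξ⁻¹χ.
  refine Fintype.sum_equiv (Equiv.mulLeft ξ⁻¹) _ _ fun χ => ?_
  simp

/-- The quantum isomorphism from functions on `V × G` to the crossed product as a linear map. -/
noncomputable def isoLinear : (V × G → ℂ) →ₗ[ℂ] CrossedProduct (permAction α) ⊗[ℂ]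
    (HilbertSpan (AddChar G ℂ) →L[ℂ] HilbertSpan (AddChar G ℂ)) :=
  (charBasis V G).constr ℂ fun p => isoOn α p.2 (Pi.single p.1 1)

theorem isoLinear_tmulChar (ξ : AddChar G ℂ) (f : V → ℂ) :
    isoLinear α (tmulChar V ξ f) = isoOn α ξ f := by
  have : isoLinear α ∘ₗ tmulChar V ξ = isoOn α ξ := (Pi.basisFun ℂ V).ext fun v => by
    simp only [LinearMap.comp_apply, Pi.basisFun_apply, ← charBasis_apply]
    exact (charBasis V G).constr_basis ℂ _ _
  exact LinearMap.congr_fun this f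

theorem map_mul_of_basis {A C ι : Type*} [Ring A] [Algebra ℂ A] [Ring C] [Algebra ℂ C]
    (b : Module.Basis ι ℂ A) (T : A →ₗ[ℂ] C) (h : ∀ i j, T (b i * b j) = T (b i) * T (b j))
    (x y : A) : T (x * y) = T x * T y := by
  have : (LinearMap.mul ℂ A).compr₂ T = (LinearMap.mul ℂ C).compl₁₂ T T :=
    b.ext fun i => b.ext fun j => h i j
  exact LinearMap.congr_fun₂ this x y

theorem isoLinear_mul (x y : V × G → ℂ) :
    isoLinear α (x * y) = isoLinear α x * isoLinear α y := by
  refine map_mul_of_basis (C := CrossedProduct (permAction α) ⊗[ℂ]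
    (HilbertSpan (AddChar G ℂ) →L[ℂ] HilbertSpan (AddChar G ℂ))) (charBasis V G)
    (isoLinear α) (fun ⟨v, ξ⟩ ⟨w, η⟩ => ?_) x y
  rw [charBasis_apply, charBasis_apply, tmulChar_mul_tmulChar, isoLinear_tmulChar,
    isoLinear_tmulChar, isoLinear_tmulChar, isoOn_mul_isoOn]

theorem isoLinear_star (x : V × G → ℂ) : isoLinear α (star x) = star (isoLinear α x) := by
  rw [← (charBasis V G).sum_repr x]
  simp only [star_sum, tensor_star_sum, star_smul, map_sum, map_smul]
  refine Finset.sum_congr rfl fun ⟨v, ξ⟩ _ => ?_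
  rw [charBasis_apply, star_tmulChar, isoLinear_tmulChar, isoLinear_tmulChar, star_isoOn]

/-- The quantum isomorphism from functions on `V × G` to the crossed product. -/
noncomputable def isoHom : (V × G → ℂ) →⋆ₐ[ℂ] CrossedProduct (permAction α) ⊗[ℂ]
    (HilbertSpan (AddChar G ℂ) →L[ℂ] HilbertSpan (AddChar G ℂ)) :=
  { toAlgHom := AlgHom.ofLinearMap (isoLinear α)
      (by rw [one_eq_tmulChar, isoLinear_tmulChar, isoOn_one]) (isoLinear_mul α)
    map_star' := isoLinear_star α }

theorem isoHom_apply (x : V × G → ℂ) : isoHom α x = isoLinear α x := rfl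

theorem isQuantumSetIso_isoHom :
    IsQuantumSetIso (classicalFunctional (V × G))
      (functional (permAction α) (classicalFunctional V)) (isoHom α) := by
  classical
  -- Only the matrix unit with column χ acts nontrivially on the basis vector δ_χ, and its row is
  -- ξχ. Thus e_v ⊗ ξ ⊗ δ_χ goes to e_{(ξχ)·v} u_ξ ⊗ δ_{ξχ}, a bijection of index sets.
  let σ : (V × AddChar G ℂ) × AddChar G ℂ ≃ (V × AddChar G ℂ) × AddChar G ℂ :=
    { toFun := fun p => ((α (p.1.2 * p.2) p.1.1, p.1.2), p.1.2 * p.2)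
      invFun := fun p => (((α p.2)⁻¹ p.1.1, p.1.2), p.1.2⁻¹ * p.2)
      left_inv := fun p => by simp
      right_inv := fun p => by simp }
  refine (isOrthogonalBasis_charBasis.tensor (isOrthogonalBasis_hilbertBasis _)).isUnitary
    ((isOrthogonalBasis_crossedBasis α).tensor (isOrthogonalBasis_hilbertBasis _)) σ ?_
  rintro ⟨⟨v, ξ⟩, χ⟩
  change _ = ((crossedBasis α).tensorProduct (hilbertBasis (AddChar G ℂ)))
    ((α (ξ * χ) v, ξ), ξ * χ)
  rw [Module.Basis.tensorProduct_apply, Module.Basis.tensorProduct_apply, crossedBasis_apply,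
    charBasis_apply]
  change tensorAct _ _ (isoHom α (tmulChar V ξ (Pi.single v 1))) (1 ⊗ₜ _) = _
  have hact : ∀ (b c : CrossedProduct (permAction α))
      (T : HilbertSpan (AddChar G ℂ) →L[ℂ] HilbertSpan (AddChar G ℂ)) (x),
      tensorAct (CrossedProduct (permAction α)) _ (b ⊗ₜ T) (c ⊗ₜ x) = (b * c) ⊗ₜ T x :=
    fun _ _ _ _ => rfl
  rw [isoHom_apply, isoLinear_tmulChar, isoOn_apply, map_sum, LinearMap.sum_apply,
    Finset.sum_eq_single (ξ * χ)]
  · rw [hact, inv_mul_cancel_left, matrixUnit_apply_hilbertBasis, if_pos rfl, mul_one,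
      permAction_single]
  · intro ζ _ h
    have : ξ⁻¹ * ζ ≠ χ := fun h' => h (by rw [← h', mul_inv_cancel_left])
    rw [hact, matrixUnit_apply_hilbertBasis, if_neg this, TensorProduct.tmul_zero]
  · simp

end Iso

end QGraph

theorem mainTheorem4 {V E G : Type*} [Fintype V] [DecidableEq V] [Fintype E]
    [AddCommGroup G] [Fintype G] [DecidableEq G]
    (Γ : QGraph.VoltageGraph V E G) (hΓ : Γ.IsPreSimple)
    (α : AddChar G ℂ →* Equiv.Perm V) (hα : Γ.IsInvariant α) :
    QGraph.IsVoltageQuantumGraph (QGraph.classicalFunctional V) (QGraph.permAction α)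
        Γ.adjacencyFamily ∧
      QGraph.QuantumIsomorphic
        (QGraph.classicalFunctional (V × G)) Γ.derivedGraph.adjacencyMap
        (QGraph.CrossedProduct.functional (QGraph.permAction α) (QGraph.classicalFunctional V))
        (QGraph.derivedQuantumGraph (QGraph.classicalFunctional V) (QGraph.permAction α)
          Γ.adjacencyFamily) := by
  have hcomm := QGraph.VoltageGraph.adjacencyFamily_permAction hΓ hα
  have hadj := QGraph.VoltageGraph.adjacencyFamily_isQuantumAdjacencyMatrix hΓ
  refine ⟨⟨QGraph.isQuantumSet_classicalFunctional, QGraph.classicalFunctional_permAction α, hadj,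
    hcomm⟩, QGraph.VoltageGraph.derivedGraph_isQuantumGraph hΓ,
    QGraph.derivedQuantumGraph_isQuantumGraph α hcomm hadj,
    QGraph.HilbertSpan (AddChar G ℂ), inferInstance, inferInstance, inferInstance,
    QGraph.isoHom α, inferInstance, ?_, QGraph.isQuantumSetIso_isoHom α, fun a => ?_⟩
  · have : Nonempty (Fin (Fintype.card (AddChar G ℂ))) := ⟨⟨0, Fintype.card_pos⟩⟩
    infer_instance
  · rw [QGraph.isoHom_apply, QGraph.isoHom_apply]
    refine LinearMap.congr_fun (f := QGraph.isoLinear α ∘ₗ Γ.derivedGraph.adjacencyMap)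
      (g := TensorProduct.map _ _ ∘ₗ QGraph.isoLinear α)
      ((QGraph.charBasis V G).ext fun ⟨v, ξ⟩ => ?_) a
    rw [LinearMap.comp_apply, LinearMap.comp_apply, QGraph.charBasis_apply,
      QGraph.VoltageGraph.derivedGraph_adjacencyMap_tmulChar, QGraph.isoLinear_tmulChar,
      QGraph.isoLinear_tmulChar, QGraph.isoOn_apply, QGraph.isoOn_apply, map_sum]
    refine Finset.sum_congr rfl fun χ _ => ?_
    rw [TensorProduct.map_tmul, QGraph.derivedQuantumGraph_singleₗ α hcomm, LinearMap.id_apply]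
    -- Both sides carry the operator ∑_g conj(ξ(g)) A_g, applied before α̂_χ on one side and after
    -- it on the other.
    simp only [map_sum (QGraph.permAction α χ), map_smul (QGraph.permAction α χ), hcomm]
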